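/- Let $\mathbb O'=\mathbb H\oplus\mathbb H$ be the para-octonions (split octonions), with product $(q_1,q_2)(p_1,p_2)=(q_1p_1+\bar p_2q_2,\;p_2q_1+q_2\bar p_1)$, conjugation $\overline{(q_1,q_2)}=(\bar q_1,-q_2)$, inner product $\langle a,b\rangle=\mathrm{Re}(a\bar b)$ and $|a|^2=\langle a,a\rangle$; write $i=(i,0)$ and $l=(0,1)$. Let $U_1,U_2,U_3\subset\mathbb O'^3$ be the sets of triples $(x,y,z)$ with $|x|^2+|y|^2+|z|^2>0$ and with $x=1$, $y=1$, $z=1$, respectively, and let $\mathbb O'P^2=(U_1\cup U_2\cup U_3)/_\sim$, where $(a,b,c)\sim(d,e,f)$ iff $a=d\lambda$, $b=e\lambda$, $c=f\lambda$ for some $\lambda\in\mathbb O'$ with $|\lambda|^2>0$. This is a smooth $16$-manifold with charts $[1,u,v]\mapsto(u,v)$, $[u,1,v]\mapsto(u,v)$, $[u,v,1]\mapsto(u,v)$ on $U_1/_\sim$, $U_2/_\sim$, $U_3/_\sim$, and it carries the semi-Riemannian metric that in each of these charts is $$ds^2=\frac{|du|^2(1+|v|^2)+|dv|^2(1+|u|^2)-2\,\mathrm{Re}\big[(u\bar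 v)(dv\,d\bar u)\big]}{(1+|u|^2+|v|^2)^2}.$$ A local isometry is a smooth diffeomorphism between open subsets that preserves the metric. A semi-Riemannian manifold $(M,g)$ is called locally isotropic if for every $P\in M$ and any two non-zero tangent vectors $v,w\in T_PM$ with $g(v,v)=g(w,w)$ there is a local isometry $\mathcal I$, defined near $P$, with $\mathcal I(P)=P$ and $d\mathcal I_P(v)=w$. Theorem. The split octonionic plane $\mathbb O'P^2$ is not locally isotropic. More precisely, identify $T_{[1,0,0]}\mathbb O'P^2$ with $\mathbb O'\times\mathbb O'$ through the chart $[1,u,v]\mapsto(u,v)$. Then $v=(i+l,0)$ and $w=(1,l)$ are non-zero null vectors at $[1,0,0]$, and there is no local isometry $\mathcal I$ of $\mathbb O'P^2$, defined near $[1,0,0]$, with $\mathcal I([1,0,0])=[1,0,0]$ and $d\mathcal I_{[1,0,0]}(v)=w$. -/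

import Mathlib

open scoped Manifold ContDiff Topology

/-! ### Local isotropy of a manifold with a field of symmetric bilinear forms -/

section LocalIsotropy

variable {E : Type*} [NormedAddCommGroup E] [NormedSpace ℝ E]
  {H : Type*} [TopologicalSpace H] (I : ModelWithCorners ℝ E H)
  {M : Type*} [TopologicalSpace M] [ChartedSpace H M]

/-- A local isometry of `(M, g)`: a smooth diffeomorphism `f` between open subsets of `M`
with `f^* g = g`. -/
def IsLocalIsometry (g : ∀ p : M, LinearMap.BilinForm ℝ (TangentSpace I p))
    (f : PartialDiffeomorph I I M M ∞) : Prop :=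
  ∀ q ∈ f.source, ∀ a b : TangentSpace I q,
    g (f q) (mfderiv I I f q a) (mfderiv I I f q b) = g q a b

/-- Some local isometry `f` defined near `p` satisfies `f p = p` and `df_p v = w`. -/
def ExistsLocalIsometryMapping (g : ∀ p : M, LinearMap.BilinForm ℝ (TangentSpace I p))
    (p : M) (v w : TangentSpace I p) : Prop :=
  ∃ f : PartialDiffeomorph I I M M ∞, p ∈ f.source ∧ IsLocalIsometry I g f ∧
    tangentMap I I f (⟨p, v⟩ : TangentBundle I M) = ⟨p, w⟩

/-- `(M, g)` is locally isotropic: at every point `p`, any two non-zero tangent vectors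
`v`, `w` with `g(v,v) = g(w,w)` are related by a local isometry fixing `p`. -/
def IsLocallyIsotropic (g : ∀ p : M, LinearMap.BilinForm ℝ (TangentSpace I p)) : Prop :=
  ∀ (p : M) (v w : TangentSpace I p), v ≠ 0 → w ≠ 0 → g p v v = g p w w →
    ExistsLocalIsometryMapping I g p v w

end LocalIsotropy

noncomputable section

/-! ### Para-octonions (split octonions) -/

/-- The para-octonions: `ℍ ⊕ ℍ` with the split Cayley-Dickson product. The norm inherited from
`ℍ × ℍ` only serves to provide the standard topology of `ℝ⁸`. -/
def ParaOct : Type := Quaternion ℝ × Quaternion ℝ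

namespace ParaOct

open scoped Quaternion

instance : NormedAddCommGroup ParaOct :=
  inferInstanceAs (NormedAddCommGroup (Quaternion ℝ × Quaternion ℝ))

instance : NormedSpace ℝ ParaOct :=
  inferInstanceAs (NormedSpace ℝ (Quaternion ℝ × Quaternion ℝ))

/-- The para-octonion `(q₁, q₂)`. -/
def mk (q₁ q₂ : Quaternion ℝ) : ParaOct := (q₁, q₂)

instance : One ParaOct := ⟨mk 1 0⟩

/-- `(q₁,q₂)(p₁,p₂) = (q₁p₁ + p̄₂q₂, p₂q₁ + q₂p̄₁)`. -/
instance : Mul ParaOct :=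
  ⟨fun a b => mk (a.1 * b.1 + star b.2 * a.2) (b.2 * a.1 + a.2 * star b.1)⟩

/-- Conjugation `(q₁,q₂) ↦ (q̄₁, -q₂)`. -/
def conj (a : ParaOct) : ParaOct := mk (star a.1) (-a.2)

/-- The real part. -/
def re (a : ParaOct) : ℝ := a.1.re

/-- The inner product `⟨a,b⟩ = Re (a b̄)`, of signature `(4,4)`. -/
def ip (a b : ParaOct) : ℝ := re (a * conj b)

/-- The (indefinite) square norm `|a|² = ⟨a,a⟩`. -/
def nsq (a : ParaOct) : ℝ := ip a a

/-- The para-octonion `i = (i, 0)`. -/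
def i : ParaOct := mk ⟨0, 1, 0, 0⟩ 0

/-- The para-octonion `l = (0, 1)`. -/
def l : ParaOct := mk 0 1

@[simp] theorem fst_mk (p q : Quaternion ℝ) : (mk p q).1 = p := rfl
@[simp] theorem snd_mk (p q : Quaternion ℝ) : (mk p q).2 = q := rfl
@[simp] theorem fst_add (a b : ParaOct) : (a + b).1 = a.1 + b.1 := rfl
@[simp] theorem snd_add (a b : ParaOct) : (a + b).2 = a.2 + b.2 := rfl
@[simp] theorem fst_smul (r : ℝ) (a : ParaOct) : (r • a).1 = r • a.1 := rfl
@[simp] theorem snd_smul (r : ℝ) (a : ParaOct) : (r • a).2 = r • a.2 := rfl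
@[simp] theorem fst_zero : (0 : ParaOct).1 = 0 := rfl
@[simp] theorem snd_zero : (0 : ParaOct).2 = 0 := rfl
@[simp] theorem fst_one : (1 : ParaOct).1 = 1 := rfl
@[simp] theorem snd_one : (1 : ParaOct).2 = 0 := rfl
@[simp] theorem fst_mul (a b : ParaOct) : (a * b).1 = a.1 * b.1 + star b.2 * a.2 := rfl
@[simp] theorem snd_mul (a b : ParaOct) : (a * b).2 = b.2 * a.1 + a.2 * star b.1 := rfl
@[simp] theorem fst_conj (a : ParaOct) : (conj a).1 = star a.1 := rfl
@[simp] theorem snd_conj (a : ParaOct) : (conj a).2 = -a.2 := rfl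

@[ext] theorem ext {a b : ParaOct} (h₁ : a.1 = b.1) (h₂ : a.2 = b.2) : a = b := Prod.ext h₁ h₂

protected theorem one_mul (a : ParaOct) : 1 * a = a := by ext1 <;> simp
protected theorem mul_one (a : ParaOct) : a * 1 = a := by ext1 <;> simp
theorem conj_one : conj 1 = 1 := by ext1 <;> simp
theorem conj_conj (a : ParaOct) : conj (conj a) = a := by ext1 <;> simp

theorem smul_mul (r : ℝ) (a b : ParaOct) : (r • a) * b = r • (a * b) := by
  ext1 <;> simp

protected theorem mul_smul (r : ℝ) (a b : ParaOct) : a * (r • b) = r • (a * b) := by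
  ext1 <;> simp

theorem conj_smul (r : ℝ) (a : ParaOct) : conj (r • a) = r • conj a := by
  ext1 <;> simp

theorem conj_mul (a b : ParaOct) : conj (a * b) = conj b * conj a := by
  ext1 <;> simp [add_comm]

theorem nsq_eq (a : ParaOct) :
    nsq a = (a.1.re ^ 2 + a.1.imI ^ 2 + a.1.imJ ^ 2 + a.1.imK ^ 2)
      - (a.2.re ^ 2 + a.2.imI ^ 2 + a.2.imJ ^ 2 + a.2.imK ^ 2) := by
  simp [nsq, ip, re]; ring

theorem nsq_one : nsq 1 = 1 := by simp [nsq_eq]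

theorem nsq_conj (a : ParaOct) : nsq (conj a) = nsq a := by simp [nsq_eq]

theorem nsq_smul (r : ℝ) (a : ParaOct) : nsq (r • a) = r ^ 2 * nsq a := by
  simp [nsq_eq]; ring

theorem nsq_mul (a b : ParaOct) : nsq (a * b) = nsq a * nsq b := by
  simp [nsq_eq]; ring

theorem mul_conj_self (a : ParaOct) : a * conj a = nsq a • (1 : ParaOct) := by
  ext <;> simp [nsq_eq] <;> ring

theorem mul_mul_conj (a b : ParaOct) : (a * b) * conj b = nsq b • a := by
  ext <;> simp [nsq_eq] <;> ring

theorem mul_conj_mul (a b : ParaOct) : (a * conj b) * b = nsq b • a := by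
  simpa [conj_conj, nsq_conj] using mul_mul_conj a (conj b)

theorem conj_mul_mul (a b : ParaOct) : conj b * (b * a) = nsq b • a := by
  ext <;> simp [nsq_eq] <;> ring


theorem core_identity (x y a : ParaOct)
    (h : x = a ∨ y = a ∨ x = y ∨ x = 1 ∨ y = 1 ∨ a = 1) :
    (x * conj a) * (a * conj y) = nsq a • (x * conj y) := by
  rcases h with rfl | rfl | rfl | rfl | rfl | rfl
  · rw [mul_conj_self, smul_mul, ParaOct.one_mul]
  · rw [mul_conj_self, ParaOct.mul_smul, ParaOct.mul_one]
  · have h := mul_conj_self (x * conj a)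
    rw [conj_mul, conj_conj] at h
    rw [h, mul_conj_self, nsq_mul, nsq_conj, smul_smul, mul_comm]
  · rw [ParaOct.one_mul, ParaOct.one_mul, conj_mul_mul]
  · rw [conj_one, ParaOct.mul_one, ParaOct.mul_one, mul_conj_mul]
  · rw [conj_one, ParaOct.mul_one, ParaOct.one_mul, nsq_one, one_smul]

theorem contDiff_star : ContDiff ℝ ∞ (fun q : Quaternion ℝ => star q) := by
  let L : Quaternion ℝ →ₗ[ℝ] Quaternion ℝ :=
    { toFun := star, map_add' := star_add, map_smul' := fun r q => by simp }
  exact (LinearMap.toContinuousLinearMap L).contDiff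

theorem contDiff_mul : ContDiff ℝ ∞ (fun x : ParaOct × ParaOct => x.1 * x.2) := by
  have h := contDiff_star
  have h1 : ContDiff ℝ ∞ (fun x : (Quaternion ℝ × Quaternion ℝ) × (Quaternion ℝ × Quaternion ℝ) =>
      ((x.1.1 * x.2.1 + star x.2.2 * x.1.2, x.2.2 * x.1.1 + x.1.2 * star x.2.1) :
        Quaternion ℝ × Quaternion ℝ)) := by
    refine ContDiff.prodMk (ContDiff.add ?_ ?_) (ContDiff.add ?_ ?_)
    · fun_prop
    · exact ContDiff.mul (h.comp (by fun_prop)) (by fun_prop)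
    · fun_prop
    · exact ContDiff.mul (by fun_prop) (h.comp (by fun_prop))
  exact h1

theorem contDiff_conj : ContDiff ℝ ∞ conj := by
  have h1 : ContDiff ℝ ∞ (fun x : Quaternion ℝ × Quaternion ℝ =>
      ((star x.1, -x.2) : Quaternion ℝ × Quaternion ℝ)) :=
    (contDiff_star.comp contDiff_fst).prodMk contDiff_snd.neg
  exact h1

theorem contDiff_nsq : ContDiff ℝ ∞ nsq := by
  have h : ContDiff ℝ ∞ (fun x : Quaternion ℝ × Quaternion ℝ => ‖x.1‖ ^ 2 - ‖x.2‖ ^ 2) :=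
    (contDiff_fst.norm_sq ℝ).sub (contDiff_snd.norm_sq ℝ)
  have e : nsq = fun x : Quaternion ℝ × Quaternion ℝ => ‖x.1‖ ^ 2 - ‖x.2‖ ^ 2 := by
    funext x
    rw [nsq_eq, sq ‖x.1‖, sq ‖x.2‖, ← Quaternion.normSq_eq_norm_mul_self,
      ← Quaternion.normSq_eq_norm_mul_self, Quaternion.normSq_def', Quaternion.normSq_def']
  rw [e]
  exact h

protected theorem add_mul (a b c : ParaOct) : (a + b) * c = a * c + b * c := by
  ext1 <;> simp [_root_.add_mul, _root_.mul_add] <;> abel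

protected theorem mul_add (a b c : ParaOct) : a * (b + c) = a * b + a * c := by
  ext1 <;> simp [_root_.add_mul, _root_.mul_add] <;> abel

theorem conj_add (a b : ParaOct) : conj (a + b) = conj a + conj b := by
  ext1 <;> simp [add_comm]

theorem re_add (a b : ParaOct) : re (a + b) = re a + re b := rfl

theorem re_smul (r : ℝ) (a : ParaOct) : re (r • a) = r * re a := rfl

end ParaOct

/-! ### The para-octonionic projective plane -/

open ParaOct
open scoped Quaternion

/-- `U_i ⊂ 𝕆'³`: triples `p` with `p_i = 1` and `|p_0|² + |p_1|² + |p_2|² > 0`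
(indices run over `0, 1, 2`). -/
def affinePiece (i : Fin 3) : Set (Fin 3 → ParaOct) :=
  {p | p i = 1 ∧ 0 < ∑ j, nsq (p j)}

/-- The set `𝒰 = U_0 ∪ U_1 ∪ U_2` of reduced homogeneous coordinates. -/
def reducedTriples : Set (Fin 3 → ParaOct) := ⋃ i, affinePiece i

/-- `p ∼ q` iff `p = q λ` for some `λ` with `|λ|² > 0`. -/
def PlaneRel (p q : Fin 3 → ParaOct) : Prop :=
  ∃ lam : ParaOct, 0 < nsq lam ∧ ∀ j, p j = q j * lam

/-- For related reduced triples, the products `p_j p̄_k` are proportional. -/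
theorem PlaneRel.mul_conj {p q : Fin 3 → ParaOct} (hp : p ∈ reducedTriples)
    (hq : q ∈ reducedTriples) {lam : ParaOct} (h : ∀ j, p j = q j * lam) (j k : Fin 3) :
    p j * conj (p k) = nsq lam • (q j * conj (q k)) := by
  obtain ⟨a, ha, -⟩ := Set.mem_iUnion.1 hp
  obtain ⟨b, hb, -⟩ := Set.mem_iUnion.1 hq
  have h1 : q a * lam = 1 := by rw [← h a, ha]
  have hn : nsq (q a) * nsq lam = 1 := by rw [← nsq_mul, h1, nsq_one]
  have hn0 : nsq (q a) ≠ 0 := left_ne_zero_of_mul_eq_one hn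
  have hl : lam = (nsq (q a))⁻¹ • conj (q a) := by
    have h2 := conj_mul_mul lam (q a)
    rw [h1, ParaOct.mul_one] at h2
    rw [h2, smul_smul, inv_mul_cancel₀ hn0, one_smul]
  have hcond : q j = q a ∨ q k = q a ∨ q j = q k ∨ q j = 1 ∨ q k = 1 ∨ q a = 1 := by
    by_cases h1 : j = a
    · left; rw [h1]
    by_cases h2 : k = a
    · right; left; rw [h2]
    by_cases h3 : j = k
    · right; right; left; rw [h3]
    have : b = j ∨ b = k ∨ b = a := by omega
    rcases this with rfl | rfl | rfl <;> simp [hb]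
  rw [h j, h k, hl, conj_mul, conj_smul, conj_conj, ParaOct.mul_smul, smul_mul, smul_mul,
    ParaOct.mul_smul, core_identity _ _ _ hcond, nsq_smul, nsq_conj, smul_smul, smul_smul]
  congr 1
  field_simp

theorem PlaneRel.of_proportional {p q : Fin 3 → ParaOct} (hp : p ∈ reducedTriples) {c : ℝ}
    (hc : 0 < c) (h : ∀ j k, p j * conj (p k) = c • (q j * conj (q k))) : PlaneRel p q := by
  obtain ⟨a, ha, -⟩ := Set.mem_iUnion.1 hp
  have haa : c * nsq (q a) = 1 := by
    have h1 := congrArg re (h a a)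
    rw [ha, conj_one, ParaOct.mul_one, re_smul] at h1
    exact h1.symm
  have hpos : 0 < nsq (q a) := by
    by_contra hcon
    nlinarith [not_lt.1 hcon]
  refine ⟨c • conj (q a), ?_, fun j => ?_⟩
  · rw [nsq_smul, nsq_conj]; positivity
  · have h1 := h j a
    rw [ha, conj_one, ParaOct.mul_one] at h1
    rw [h1, ParaOct.mul_smul]

theorem planeRel_equivalence :
    Equivalence (fun p q : reducedTriples => PlaneRel p.1 q.1) where
  refl p := ⟨1, by rw [nsq_one]; exact one_pos, fun j => (ParaOct.mul_one _).symm⟩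
  symm := by
    rintro p q ⟨lam, hl, h⟩
    refine PlaneRel.of_proportional q.2 (inv_pos.2 hl) fun j k => ?_
    rw [PlaneRel.mul_conj p.2 q.2 h, smul_smul, inv_mul_cancel₀ hl.ne', one_smul]
  trans := by
    rintro p q r ⟨lam, hl, h⟩ ⟨mu, hm, h'⟩
    refine PlaneRel.of_proportional p.2 (mul_pos hl hm) fun j k => ?_
    rw [PlaneRel.mul_conj p.2 q.2 h, PlaneRel.mul_conj q.2 r.2 h', smul_smul]

instance planeSetoid : Setoid reducedTriples := ⟨_, planeRel_equivalence⟩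

/-- The para-octonionic projective plane `𝕆'P² = 𝒰/∼`. -/
def ParaOctPlane : Type := Quotient planeSetoid

/-- The model space `𝕆' × 𝕆' = ℝ¹⁶` of the charts. -/
abbrev ParaOctPair : Type := ParaOct × ParaOct

namespace ParaOctPlane

/-- The quotient topology. -/
instance : TopologicalSpace ParaOctPlane := inferInstanceAs (TopologicalSpace (Quotient planeSetoid))

/-- The class `[p_0, p_1, p_2]`. -/
def mk (p : reducedTriples) : ParaOctPlane := Quotient.mk planeSetoid p

theorem isQuotientMap_mk : Topology.IsQuotientMap mk := isQuotientMap_quotient_mk'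

/-- `p_j p_i⁻¹` for `P = [p]`: for `P ∈ U_i/∼` this is the `j`-th coordinate of the
representative of `P` whose `i`-th coordinate is `1`. -/
def coord (i j : Fin 3) : ParaOctPlane → ParaOct :=
  Quotient.lift (fun p : reducedTriples => (nsq (p.1 i))⁻¹ • (p.1 j * conj (p.1 i))) (by
    rintro p q ⟨lam, hl, h⟩
    have hn : nsq (p.1 i) = nsq (q.1 i) * nsq lam := by rw [h i, nsq_mul]
    rw [PlaneRel.mul_conj p.2 q.2 h, hn, smul_smul, mul_inv, mul_assoc,
      inv_mul_cancel₀ hl.ne', _root_.mul_one])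

/-- The triple with `1` in position `i` and `u`, `v` in the remaining two positions, in order. -/
def insertOne (i : Fin 3) (x : ParaOctPair) : Fin 3 → ParaOct :=
  i.insertNth (α := fun _ => ParaOct) 1 ![x.1, x.2]

@[simp] theorem insertOne_same (i : Fin 3) (x : ParaOctPair) : insertOne i x i = 1 := by
  simp [insertOne]

@[simp] theorem insertOne_zero (i : Fin 3) (x : ParaOctPair) :
    insertOne i x (i.succAbove 0) = x.1 := by
  simp [insertOne]

@[simp] theorem insertOne_one (i : Fin 3) (x : ParaOctPair) :
    insertOne i x (i.succAbove 1) = x.2 := by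
  simp [insertOne]

theorem insertOne_eta {i : Fin 3} {p : Fin 3 → ParaOct} (hp : p i = 1) :
    insertOne i (p (i.succAbove 0), p (i.succAbove 1)) = p := by
  funext j
  rcases Fin.eq_self_or_eq_succAbove i j with rfl | ⟨k, rfl⟩
  · simp [hp]
  · fin_cases k
    · exact insertOne_zero _ _
    · exact insertOne_one _ _

theorem sum_nsq_insertOne (i : Fin 3) (x : ParaOctPair) :
    ∑ j, nsq (insertOne i x j) = 1 + nsq x.1 + nsq x.2 := by
  rw [Fin.sum_univ_succAbove _ i, Fin.sum_univ_two]
  simp [nsq_one, add_assoc]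

/-- The common image of the three charts: `1 + |u|² + |v|² > 0`. -/
def chartTarget : Set ParaOctPair := {x | 0 < 1 + nsq x.1 + nsq x.2}

theorem insertOne_mem_affinePiece {i : Fin 3} {x : ParaOctPair} (hx : x ∈ chartTarget) :
    insertOne i x ∈ affinePiece i :=
  ⟨insertOne_same i x, by rw [sum_nsq_insertOne]; exact hx⟩

theorem pair_mem_chartTarget {i : Fin 3} {p : Fin 3 → ParaOct} (hp : p ∈ affinePiece i) :
    (p (i.succAbove 0), p (i.succAbove 1)) ∈ chartTarget := by
  have h := hp.2
  rw [← insertOne_eta hp.1, sum_nsq_insertOne] at h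
  exact h

/-- The triple `insertOne i x` as an element of `𝒰`. -/
def insertTriple (i : Fin 3) (x : chartTarget) : reducedTriples :=
  ⟨insertOne i x.1, Set.mem_iUnion.2 ⟨i, insertOne_mem_affinePiece x.2⟩⟩

/-- The base point `[1, 0, 0]`. -/
def basePoint : ParaOctPlane :=
  mk ⟨![1, 0, 0], Set.mem_iUnion.2 ⟨0, rfl, by simp [Fin.sum_univ_three, nsq_eq]⟩⟩

open Classical in
/-- `(u, v) ↦ [1, u, v]`, `[u, 1, v]` or `[u, v, 1]`, for `i = 0, 1, 2`
(with a dummy value outside the image of the chart). -/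
def chartInv (i : Fin 3) (x : ParaOctPair) : ParaOctPlane :=
  if hx : x ∈ chartTarget then mk (insertTriple i ⟨x, hx⟩) else basePoint

theorem chartInv_of_mem {i : Fin 3} {x : ParaOctPair} (hx : x ∈ chartTarget) :
    chartInv i x = mk (insertTriple i ⟨x, hx⟩) := dif_pos hx

/-- The chart domain `U_i/∼`. -/
def chartSource (i : Fin 3) : Set ParaOctPlane := mk '' {p | p.1 ∈ affinePiece i}

theorem mk_mem_chartSource {i : Fin 3} {p : reducedTriples} :
    mk p ∈ chartSource i ↔ 0 < nsq (p.1 i) := by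
  constructor
  · rintro ⟨q, ⟨hq, -⟩, hqp⟩
    obtain ⟨lam, hl, h⟩ : PlaneRel q.1 p.1 := Quotient.exact hqp
    have h1 : nsq (p.1 i) * nsq lam = 1 := by rw [← nsq_mul, ← h i, hq, nsq_one]
    by_contra hcon
    nlinarith [not_lt.1 hcon]
  · intro hi
    have hc : 0 < nsq ((nsq (p.1 i))⁻¹ • conj (p.1 i)) := by
      rw [nsq_smul, nsq_conj]; positivity
    let q : Fin 3 → ParaOct := fun j => p.1 j * ((nsq (p.1 i))⁻¹ • conj (p.1 i))
    have hq : q ∈ affinePiece i := by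
      refine ⟨?_, ?_⟩
      · simp only [q]
        rw [ParaOct.mul_smul, mul_conj_self, smul_smul, inv_mul_cancel₀ hi.ne', one_smul]
      · obtain ⟨b, -, hb⟩ := Set.mem_iUnion.1 p.2
        simp only [q, nsq_mul, ← Finset.sum_mul]
        exact mul_pos hb hc
    exact ⟨⟨q, Set.mem_iUnion.2 ⟨i, hq⟩⟩, hq, Quotient.sound ⟨_, hc, fun _ => rfl⟩⟩

theorem coord_mk (i j : Fin 3) (p : reducedTriples) :
    coord i j (mk p) = (nsq (p.1 i))⁻¹ • (p.1 j * conj (p.1 i)) := rfl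

theorem coord_mk_of_eq_one {i j : Fin 3} {p : reducedTriples} (hp : p.1 i = 1) :
    coord i j (mk p) = p.1 j := by
  rw [coord_mk, hp, conj_one, nsq_one, ParaOct.mul_one, inv_one, one_smul]

/-- The underlying bijection of the chart `φ_i`. -/
def chartEquiv (i : Fin 3) : PartialEquiv ParaOctPlane ParaOctPair where
  toFun P := (coord i (i.succAbove 0) P, coord i (i.succAbove 1) P)
  invFun := chartInv i
  source := chartSource i
  target := chartTarget
  map_source' := by
    rintro _ ⟨p, ⟨hp, hpos⟩, rfl⟩
    rw [coord_mk_of_eq_one hp, coord_mk_of_eq_one hp]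
    exact pair_mem_chartTarget ⟨hp, hpos⟩
  map_target' x hx := by
    rw [chartInv, dif_pos hx]
    exact ⟨_, insertOne_mem_affinePiece hx, rfl⟩
  left_inv' := by
    rintro _ ⟨p, ⟨hp, hpos⟩, rfl⟩
    rw [coord_mk_of_eq_one hp, coord_mk_of_eq_one hp]
    have hx : (p.1 (i.succAbove 0), p.1 (i.succAbove 1)) ∈ chartTarget :=
      pair_mem_chartTarget ⟨hp, hpos⟩
    rw [chartInv, dif_pos hx]
    congr 1
    exact Subtype.ext (insertOne_eta hp)
  right_inv' x hx := by
    rw [chartInv, dif_pos hx, coord_mk_of_eq_one (insertOne_same i x),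
      coord_mk_of_eq_one (insertOne_same i x)]
    simp [insertTriple]

theorem isOpen_chartTarget : IsOpen chartTarget := by
  have h := contDiff_nsq.continuous
  exact isOpen_lt continuous_const (by fun_prop)

theorem continuous_apply_val (i : Fin 3) : Continuous fun p : reducedTriples => p.1 i :=
  (continuous_apply i).comp continuous_subtype_val

theorem isOpen_chartSource (i : Fin 3) : IsOpen (chartSource i) := by
  rw [← isQuotientMap_mk.isOpen_preimage]
  have h : mk ⁻¹' chartSource i = {p | 0 < nsq (p.1 i)} := by
    ext p; exact mk_mem_chartSource
  rw [h]
  exact isOpen_lt continuous_const (contDiff_nsq.continuous.comp (continuous_apply_val i))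

theorem continuous_insertOne (i : Fin 3) : Continuous (insertOne i) := by
  refine continuous_pi fun j => ?_
  rcases Fin.eq_self_or_eq_succAbove i j with rfl | ⟨k, rfl⟩
  · simp only [insertOne_same]; exact continuous_const
  · fin_cases k
    · exact continuous_fst.congr fun x => (insertOne_zero i x).symm
    · exact continuous_snd.congr fun x => (insertOne_one i x).symm

theorem continuousOn_coord (i j : Fin 3) : ContinuousOn (coord i j) (chartSource i) := by
  rw [isQuotientMap_mk.continuousOn_isOpen_iff (isOpen_chartSource i)]
  have h1 := contDiff_nsq.continuous
  have h2 := contDiff_mul.continuous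
  have h3 := contDiff_conj.continuous
  have h4 : ContinuousOn (fun p : reducedTriples => (nsq (p.1 i))⁻¹ • (p.1 j * conj (p.1 i)))
      (mk ⁻¹' chartSource i) := by
    refine ContinuousOn.fun_smul (f := fun p : reducedTriples => (nsq (p.1 i))⁻¹)
      (g := fun p : reducedTriples => p.1 j * conj (p.1 i))
      (ContinuousOn.inv₀ (f := fun p : reducedTriples => nsq (p.1 i)) ?_ fun p hp => ?_) ?_
    · exact (h1.comp (continuous_apply_val i)).continuousOn
    · exact (mk_mem_chartSource.1 hp).ne'
    · have h5 : Continuous fun p : reducedTriples => (p.1 j, conj (p.1 i)) :=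
        (continuous_apply_val j).prodMk (h3.comp (continuous_apply_val i))
      exact (h2.comp h5).continuousOn
  exact h4

/-- The chart `φ_i` on `U_i/∼`: `φ_0 [1,u,v] = (u,v)`, `φ_1 [u,1,v] = (u,v)`,
`φ_2 [u,v,1] = (u,v)`. -/
def chart (i : Fin 3) : OpenPartialHomeomorph ParaOctPlane ParaOctPair where
  toPartialEquiv := chartEquiv i
  open_source := isOpen_chartSource i
  open_target := isOpen_chartTarget
  continuousOn_toFun := (continuousOn_coord i _).prodMk (continuousOn_coord i _)
  continuousOn_invFun := by
    rw [continuousOn_iff_continuous_domRestrict]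
    have h : Continuous fun x : chartTarget => mk (insertTriple i x) := by
      refine isQuotientMap_mk.continuous.comp ?_
      exact ((continuous_insertOne i).comp continuous_subtype_val).subtype_mk _
    refine h.congr fun x => ?_
    exact (chartInv_of_mem x.2).symm

theorem exists_mem_chartSource (P : ParaOctPlane) : ∃ i, P ∈ chartSource i := by
  obtain ⟨p, rfl⟩ := isQuotientMap_mk.surjective P
  obtain ⟨i, hi⟩ := Set.mem_iUnion.1 p.2
  exact ⟨i, p, hi, rfl⟩

open Classical in
/-- The first index `i` with `P ∈ U_i/∼`. -/
def chartIndex (P : ParaOctPlane) : Fin 3 := Fin.find (P ∈ chartSource ·) (exists_mem_chartSource P)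

/-- The atlas `φ_0, φ_1, φ_2`. -/
instance : ChartedSpace ParaOctPair ParaOctPlane where
  atlas := Set.range chart
  chartAt P := chart (chartIndex P)
  mem_chart_source P := by
    classical exact Fin.find_spec (exists_mem_chartSource P)
  chart_mem_atlas P := ⟨_, rfl⟩

theorem chartAt_eq (P : ParaOctPlane) : chartAt ParaOctPair P = chart (chartIndex P) := rfl

theorem contDiff_insertOne (i j : Fin 3) : ContDiff ℝ ∞ fun x => insertOne i x j := by
  rcases Fin.eq_self_or_eq_succAbove i j with rfl | ⟨k, rfl⟩
  · simp only [insertOne_same]; exact contDiff_const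
  · fin_cases k
    · have h : (fun x => insertOne i x (i.succAbove 0)) = Prod.fst := funext (insertOne_zero i)
      exact h ▸ contDiff_fst
    · have h : (fun x => insertOne i x (i.succAbove 1)) = Prod.snd := funext (insertOne_one i)
      exact h ▸ contDiff_snd

/-- The transition maps are smooth. -/
instance : IsManifold 𝓘(ℝ, ParaOctPair) ∞ ParaOctPlane := by
  apply isManifold_of_contDiffOn
  rintro _ _ ⟨i, rfl⟩ ⟨j, rfl⟩
  have hs : ∀ x ∈ ((chart i).symm ≫ₕ chart j).source,
      x ∈ chartTarget ∧ nsq (insertOne i x j) ≠ 0 := by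
    rintro x ⟨hx, hx'⟩
    have hx1 : x ∈ chartTarget := hx
    have hx2 : chartInv i x ∈ chartSource j := hx'
    rw [chartInv_of_mem hx1, mk_mem_chartSource] at hx2
    exact ⟨hx1, hx2.ne'⟩
  have key : ∀ k, ContDiffOn ℝ ∞ (fun x => coord j k (chartInv i x))
      ((chart i).symm ≫ₕ chart j).source := by
    intro k
    have h1 : ContDiffOn ℝ ∞ (fun x => (nsq (insertOne i x j))⁻¹ •
        (insertOne i x k * conj (insertOne i x j))) ((chart i).symm ≫ₕ chart j).source := by
      refine ContDiffOn.smul (ContDiffOn.inv ?_ fun x hx => (hs x hx).2) ?_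
      · exact (contDiff_nsq.comp (contDiff_insertOne i j)).contDiffOn
      · exact (contDiff_mul.comp ((contDiff_insertOne i k).prodMk
          (contDiff_conj.comp (contDiff_insertOne i j)))).contDiffOn
    refine h1.congr fun x hx => ?_
    rw [chartInv_of_mem (hs x hx).1]
    rfl
  have h := (key (j.succAbove 0)).prodMk (key (j.succAbove 1))
  simp only [modelWithCornersSelf_coe, modelWithCornersSelf_coe_symm, Function.id_comp,
    Function.comp_id, Set.range_id, Set.inter_univ, Set.preimage_id_eq, id_eq]
  exact h

/-! ### The metric -/

/-- The symmetric bilinear form at `x = (u, v)` whose quadratic form is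
`ds² = (|du|²(1+|v|²) + |dv|²(1+|u|²) - 2 Re[(u v̄)(dv dū)]) / (1+|u|²+|v|²)²`. -/
def metricForm (x : ParaOctPair) : LinearMap.BilinForm ℝ ParaOctPair :=
  LinearMap.mk₂ ℝ
    (fun a b => (ip a.1 b.1 * (1 + nsq x.2) + ip a.2 b.2 * (1 + nsq x.1)
      - re ((x.1 * conj x.2) * (a.2 * conj b.1)) - re ((x.1 * conj x.2) * (b.2 * conj a.1)))
        / (1 + nsq x.1 + nsq x.2) ^ 2)
    (fun a a' b => by
      simp only [ip, Prod.fst_add, Prod.snd_add, ParaOct.add_mul, ParaOct.mul_add, conj_add, re_add]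
      ring)
    (fun c a b => by
      simp only [ip, Prod.smul_fst, Prod.smul_snd, smul_mul, ParaOct.mul_smul, conj_smul, re_smul,
        smul_eq_mul]
      ring)
    (fun a b b' => by
      simp only [ip, Prod.fst_add, Prod.snd_add, ParaOct.add_mul, ParaOct.mul_add, conj_add, re_add]
      ring)
    (fun c a b => by
      simp only [ip, Prod.smul_fst, Prod.smul_snd, smul_mul, ParaOct.mul_smul, conj_smul, re_smul,
        smul_eq_mul]
      ring)

/-- On the diagonal `metricForm` is the line element `ds²`. -/
theorem metricForm_self (u v du dv : ParaOct) :
    metricForm (u, v) (du, dv) (du, dv) =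
      (nsq du * (1 + nsq v) + nsq dv * (1 + nsq u) - 2 * re ((u * conj v) * (dv * conj du)))
        / (1 + nsq u + nsq v) ^ 2 := by
  simp only [metricForm, LinearMap.mk₂_apply, nsq]
  ring

/-- The metric of `𝕆'P²`, given in the chart by `metricForm`. A tangent vector at `P` is
represented by its components in the chart `chartAt P`, and the expression `ds²` is invariant
under the transition maps, so that the same formula holds in all three charts. -/
def metric (P : ParaOctPlane) : LinearMap.BilinForm ℝ (TangentSpace 𝓘(ℝ, ParaOctPair) P) :=
  metricForm (chartAt ParaOctPair P P)

/-- Tangent vectors at `[1,0,0]` are represented by their components in the chart `φ_0`. -/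
theorem chartAt_basePoint : chartAt ParaOctPair basePoint = chart 0 := by
  classical
  rw [chartAt_eq]
  congr 1
  have h : basePoint ∈ chartSource 0 := by
    rw [basePoint, mk_mem_chartSource]
    simp [nsq_eq]
  exact (Fin.find_eq_iff _).2 ⟨h, fun j hj => absurd hj (Fin.not_lt_zero j)⟩

/-- The tangent vector `(a, b)` at `[1,0,0]`. -/
def baseVec (a b : ParaOct) : TangentSpace 𝓘(ℝ, ParaOctPair) basePoint := ((a, b) : ParaOctPair)

end ParaOctPlane

end

open scoped Quaternion

/-! ### Second order jets of curves -/

section Jets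

variable {V W X : Type*} [NormedAddCommGroup V] [NormedSpace ℝ V]
  [NormedAddCommGroup W] [NormedSpace ℝ W] [NormedAddCommGroup X] [NormedSpace ℝ X]

/-! The obstruction is curvature. Where defined, an isometry fixing `[1,0,0]` preserves the form
R(x,a,a,x) there, and this form separates the two null vectors. If e is null, then R(x,a,a,x) = 4
g(x,a)² for x = (e,0) and every a (`curvature_of_left_null`), so it is never negative; for x = (1,l)
the choice a = (i,0) gives -3 (`curvature_one_l_i_zero`). The differential at the fixed point is
onto, so if it carried (i+l,0) to (1,l), some a would be carried to (i,0), and a nonnegative number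
would equal -3.

No connection is needed for the invariance of R. In the chart the metric at the origin is g₀ with
vanishing first derivatives, plus a second order part `metricQuad`. Comparing the two-jets of F*g
and g along lines (`metric_jet_comparison`) shows that DF preserves g₀, that D²F = 0 at the origin
by the Koszul permutation argument, and that `metricQuad` changes only by terms in D³F. The
combination `curvature` of values of `metricQuad` is the one in which these terms cancel by the
symmetry of D³F (`curvature_fderiv_of_isometry`). -/

/-- The curve `F` is twice differentiable at `0`, with value `c₀`, velocity `c₁` and
acceleration `c₂` there. -/
def HasJetTwo (F : ℝ → V) (c₀ c₁ c₂ : V) : Prop :=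
  F 0 = c₀ ∧ ∃ F' : ℝ → V, (∀ᶠ t in 𝓝 0, HasDerivAt F (F' t) t) ∧ F' 0 = c₁ ∧ HasDerivAt F' c₂ 0

/-- `HasJetTwo` asks for the first derivative on a whole neighbourhood of 0: germs that agree then
have derivatives that agree as germs, which makes the acceleration well defined. -/
theorem HasJetTwo.unique {F G : ℝ → V} {c₀ c₁ c₂ d₀ d₁ d₂ : V} (hF : HasJetTwo F c₀ c₁ c₂)
    (hG : HasJetTwo G d₀ d₁ d₂) (h : F =ᶠ[𝓝 0] G) : c₀ = d₀ ∧ c₁ = d₁ ∧ c₂ = d₂ := by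
  obtain ⟨rfl, F', hF1, rfl, hF2⟩ := hF
  obtain ⟨rfl, G', hG1, rfl, hG2⟩ := hG
  have h' : F' =ᶠ[𝓝 0] G' := by
    filter_upwards [hF1, hG1, h.eventuallyEq_nhds] with t h1 h2 h3
    exact (h1.congr_of_eventuallyEq h3.symm).unique h2
  exact ⟨h.eq_of_nhds, h'.eq_of_nhds, (hF2.congr_of_eventuallyEq h'.symm).unique hG2⟩

theorem hasJetTwo_const (c : V) : HasJetTwo (fun _ => c) c 0 0 :=
  ⟨rfl, fun _ => 0, .of_forall fun t => hasDerivAt_const t c, rfl, hasDerivAt_const 0 0⟩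

theorem HasJetTwo.add {F G : ℝ → V} {c₀ c₁ c₂ d₀ d₁ d₂ : V} (hF : HasJetTwo F c₀ c₁ c₂)
    (hG : HasJetTwo G d₀ d₁ d₂) :
    HasJetTwo (fun t => F t + G t) (c₀ + d₀) (c₁ + d₁) (c₂ + d₂) := by
  obtain ⟨rfl, F', hF1, rfl, hF2⟩ := hF
  obtain ⟨rfl, G', hG1, rfl, hG2⟩ := hG
  refine ⟨rfl, fun t => F' t + G' t, ?_, rfl, hF2.fun_add hG2⟩
  filter_upwards [hF1, hG1] with t h1 h2 using h1.fun_add h2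

theorem HasJetTwo.sub {F G : ℝ → V} {c₀ c₁ c₂ d₀ d₁ d₂ : V} (hF : HasJetTwo F c₀ c₁ c₂)
    (hG : HasJetTwo G d₀ d₁ d₂) :
    HasJetTwo (fun t => F t - G t) (c₀ - d₀) (c₁ - d₁) (c₂ - d₂) := by
  obtain ⟨rfl, F', hF1, rfl, hF2⟩ := hF
  obtain ⟨rfl, G', hG1, rfl, hG2⟩ := hG
  refine ⟨rfl, fun t => F' t - G' t, ?_, rfl, hF2.fun_sub hG2⟩
  filter_upwards [hF1, hG1] with t h1 h2 using h1.fun_sub h2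

theorem HasJetTwo.clm (L : V →L[ℝ] W) {F : ℝ → V} {c₀ c₁ c₂ : V} (hF : HasJetTwo F c₀ c₁ c₂) :
    HasJetTwo (fun t => L (F t)) (L c₀) (L c₁) (L c₂) := by
  obtain ⟨rfl, F', hF1, rfl, hF2⟩ := hF
  refine ⟨rfl, fun t => L (F' t), ?_, rfl, L.hasFDerivAt.comp_hasDerivAt 0 hF2⟩
  filter_upwards [hF1] with t h1 using L.hasFDerivAt.comp_hasDerivAt t h1

/-- The Leibniz rule to second order. Every product below, real or para-octonionic, is an instance,
and associativity plays no role. -/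
theorem HasJetTwo.bilin (L : V →L[ℝ] W →L[ℝ] X) {F : ℝ → V} {G : ℝ → W} {c₀ c₁ c₂ : V}
    {d₀ d₁ d₂ : W} (hF : HasJetTwo F c₀ c₁ c₂) (hG : HasJetTwo G d₀ d₁ d₂) :
    HasJetTwo (fun t => L (F t) (G t)) (L c₀ d₀) (L c₀ d₁ + L c₁ d₀)
      (L c₀ d₂ + (2 : ℝ) • L c₁ d₁ + L c₂ d₀) := by
  obtain ⟨rfl, F', hF1, rfl, hF2⟩ := hF
  obtain ⟨rfl, G', hG1, rfl, hG2⟩ := hG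
  have key : ∀ {f : ℝ → V} {g : ℝ → W} {f' : V} {g' : W} {t : ℝ}, HasDerivAt f f' t →
      HasDerivAt g g' t → HasDerivAt (fun s => L (f s) (g s)) (L (f t) g' + L f' (g t)) t :=
    fun hf hg => by simpa using (L.hasFDerivAt_of_bilinear hf.hasFDerivAt hg.hasFDerivAt).hasDerivAt
  refine ⟨rfl, fun t => L (F t) (G' t) + L (F' t) (G t), ?_, rfl, ?_⟩
  · filter_upwards [hF1, hG1] with t h1 h2 using key h1 h2
  · convert (key hF1.self_of_nhds hG2).fun_add (key hF2 hG1.self_of_nhds) using 1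
    rw [two_smul]
    abel

theorem HasJetTwo.mul {F G : ℝ → ℝ} {c₀ c₁ c₂ d₀ d₁ d₂ : ℝ} (hF : HasJetTwo F c₀ c₁ c₂)
    (hG : HasJetTwo G d₀ d₁ d₂) :
    HasJetTwo (fun t => F t * G t) (c₀ * d₀) (c₀ * d₁ + c₁ * d₀)
      (c₀ * d₂ + 2 * (c₁ * d₁) + c₂ * d₀) :=
  hF.bilin (ContinuousLinearMap.mul ℝ ℝ) hG

/-- Restriction to a line turns statements about D²G into one-variable calculus. Applied to `fderiv
ℝ F`, it brings in the third derivative of F. -/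
theorem ContDiffAt.hasJetTwo_line {G : V → W} (hG : ContDiffAt ℝ 2 G 0) (x : V) :
    HasJetTwo (fun t : ℝ => G (t • x)) (G 0) (fderiv ℝ G 0 x)
      (fderiv ℝ (fderiv ℝ G) 0 x x) := by
  have hl : ∀ t : ℝ, HasDerivAt (fun t : ℝ => t • x) x t := fun t => by
    simpa using (hasDerivAt_id t).smul_const x
  have h0 : Filter.Tendsto (fun t : ℝ => t • x) (𝓝 0) (𝓝 0) := by
    simpa using (hl 0).continuousAt.tendsto
  refine ⟨by simp, fun t => fderiv ℝ G (t • x) x, ?_, by simp, ?_⟩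
  · have h1 : ∀ᶠ y in 𝓝 (0 : V), ContDiffAt ℝ 2 G y := hG.eventually (by simp)
    filter_upwards [h0.eventually h1] with t ht
    exact (ht.differentiableAt (by simp)).hasFDerivAt.comp_hasDerivAt t (hl t)
  · have h1 : ContDiffAt ℝ 1 (fderiv ℝ G) 0 := hG.fderiv_right (by norm_num)
    have h2 : HasFDerivAt (fderiv ℝ G) (fderiv ℝ (fderiv ℝ G) 0) ((0 : ℝ) • x) := by
      rw [zero_smul]
      exact (h1.differentiableAt (by simp)).hasFDerivAt
    have h3 := h2.comp_hasDerivAt 0 (hl 0)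
    exact ((ContinuousLinearMap.apply ℝ W x).hasFDerivAt.comp_hasDerivAt 0 h3)

/-- The third derivative is symmetric in its last two arguments. -/
theorem ContDiffAt.thirdFDeriv_symm_right {G : V → W} (hG : ContDiffAt ℝ 3 G 0) (x y z : V) :
    fderiv ℝ (fderiv ℝ (fderiv ℝ G)) 0 x y z = fderiv ℝ (fderiv ℝ (fderiv ℝ G)) 0 x z y := by
  have h1 : ContDiffAt ℝ 1 (fderiv ℝ (fderiv ℝ G)) 0 :=
    (hG.fderiv_right (m := 2) (by norm_num)).fderiv_right (by norm_num)
  have h2 := (h1.differentiableAt (by simp)).hasFDerivAt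
  have h3 : ∀ a b : V, HasFDerivAt (fun p => fderiv ℝ (fderiv ℝ G) p a b)
      ((ContinuousLinearMap.apply ℝ W b).comp ((ContinuousLinearMap.apply ℝ (V →L[ℝ] W) a).comp
        (fderiv ℝ (fderiv ℝ (fderiv ℝ G)) 0))) 0 := fun a b => by
    have h4 := (ContinuousLinearMap.apply ℝ (V →L[ℝ] W) a).hasFDerivAt.comp 0 h2
    exact (ContinuousLinearMap.apply ℝ W b).hasFDerivAt.comp 0 h4
  have h4 : ∀ᶠ p in 𝓝 (0 : V), ContDiffAt ℝ 3 G p := hG.eventually (by simp)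
  have h5 : (fun p => fderiv ℝ (fderiv ℝ G) p y z) =ᶠ[𝓝 0]
      fun p => fderiv ℝ (fderiv ℝ G) p z y := by
    filter_upwards [h4] with p hp
    exact (hp.isSymmSndFDerivAt (by simp; norm_num)).eq y z
  exact congrArg (fun L : V →L[ℝ] W => L x)
    (((h3 z y).congr_of_eventuallyEq h5).unique (h3 y z)).symm

theorem ContDiffAt.thirdFDeriv_symm_left {G : V → W} (hG : ContDiffAt ℝ 3 G 0) (x y : V) :
    fderiv ℝ (fderiv ℝ (fderiv ℝ G)) 0 x y = fderiv ℝ (fderiv ℝ (fderiv ℝ G)) 0 y x :=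
  ((hG.fderiv_right (m := 2) (by norm_num)).isSymmSndFDerivAt (by simp)).eq x y

end Jets

/-! ### Continuous multilinear operations on the para-octonions -/

namespace ParaOct

instance : FiniteDimensional ℝ ParaOct :=
  inferInstanceAs (FiniteDimensional ℝ (Quaternion ℝ × Quaternion ℝ))

/-- Multiplication as a continuous bilinear map. -/
noncomputable def mulCLM : ParaOct →L[ℝ] ParaOct →L[ℝ] ParaOct :=
  (LinearMap.mk₂ ℝ (fun a b : ParaOct => a * b) ParaOct.add_mul smul_mul ParaOct.mul_add
    ParaOct.mul_smul).toContinuousBilinearMap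

/-- Conjugation as a continuous linear map. -/
noncomputable def conjCLM : ParaOct →L[ℝ] ParaOct :=
  LinearMap.toContinuousLinearMap { toFun := conj, map_add' := conj_add, map_smul' := conj_smul }

/-- The real part as a continuous linear functional. -/
noncomputable def reCLM : ParaOct →L[ℝ] ℝ :=
  LinearMap.toContinuousLinearMap { toFun := re, map_add' := re_add, map_smul' := re_smul }

protected theorem zero_mul (a : ParaOct) : 0 * a = 0 := by ext1 <;> simp
protected theorem mul_zero (a : ParaOct) : a * 0 = 0 := by ext1 <;> simp
theorem conj_zero : conj 0 = 0 := by ext1 <;> simp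
theorem re_zero : re 0 = 0 := rfl
theorem fst_i_re : i.1.re = 0 := rfl
theorem fst_i_imI : i.1.imI = 1 := rfl
theorem fst_i_imJ : i.1.imJ = 0 := rfl
theorem fst_i_imK : i.1.imK = 0 := rfl
theorem snd_i : i.2 = 0 := rfl
theorem fst_l : l.1 = 0 := rfl
theorem snd_l : l.2 = 1 := rfl

theorem ip_eq (a b : ParaOct) :
    ip a b = (a.1.re * b.1.re + a.1.imI * b.1.imI + a.1.imJ * b.1.imJ + a.1.imK * b.1.imK)
      - (a.2.re * b.2.re + a.2.imI * b.2.imI + a.2.imJ * b.2.imJ + a.2.imK * b.2.imK) := by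
  simp [ip, re]; ring

theorem ip_comm (a b : ParaOct) : ip a b = ip b a := by simp only [ip_eq]; ring

theorem hasJetTwo_mul {F G : ℝ → ParaOct} {c₀ c₁ c₂ d₀ d₁ d₂ : ParaOct}
    (hF : HasJetTwo F c₀ c₁ c₂) (hG : HasJetTwo G d₀ d₁ d₂) :
    HasJetTwo (fun t => F t * G t) (c₀ * d₀) (c₀ * d₁ + c₁ * d₀)
      (c₀ * d₂ + (2 : ℝ) • (c₁ * d₁) + c₂ * d₀) :=
  hF.bilin mulCLM hG

theorem hasJetTwo_conj {F : ℝ → ParaOct} {c₀ c₁ c₂ : ParaOct} (hF : HasJetTwo F c₀ c₁ c₂) :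
    HasJetTwo (fun t => conj (F t)) (conj c₀) (conj c₁) (conj c₂) :=
  hF.clm conjCLM

theorem hasJetTwo_re {F : ℝ → ParaOct} {c₀ c₁ c₂ : ParaOct} (hF : HasJetTwo F c₀ c₁ c₂) :
    HasJetTwo (fun t => re (F t)) (re c₀) (re c₁) (re c₂) :=
  hF.clm reCLM

theorem hasJetTwo_ip {F G : ℝ → ParaOct} {c₀ c₁ c₂ d₀ d₁ d₂ : ParaOct}
    (hF : HasJetTwo F c₀ c₁ c₂) (hG : HasJetTwo G d₀ d₁ d₂) :
    HasJetTwo (fun t => ip (F t) (G t)) (ip c₀ d₀) (ip c₀ d₁ + ip c₁ d₀)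
      (ip c₀ d₂ + 2 * ip c₁ d₁ + ip c₂ d₀) :=
  hasJetTwo_re (hasJetTwo_mul hF (hasJetTwo_conj hG))

/-- For a curve through 0 the acceleration is multiplied by F(0) = 0, so only the velocity survives.
-/
theorem hasJetTwo_nsq {F : ℝ → ParaOct} {c₁ c₂ : ParaOct} (hF : HasJetTwo F 0 c₁ c₂) :
    HasJetTwo (fun t => nsq (F t)) 0 0 (2 * nsq c₁) := by
  simpa [ip, nsq, ParaOct.zero_mul, ParaOct.mul_zero, conj_zero, re_zero] using hasJetTwo_ip hF hF

/-- The jet of a product of four factors, the first two of which vanish at `0`. -/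
theorem hasJetTwo_re_mul {F G P Q : ℝ → ParaOct} {f f' g g' p₀ p₁ p₂ q₀ q₁ q₂ : ParaOct}
    (hF : HasJetTwo F 0 f f') (hG : HasJetTwo G 0 g g') (hP : HasJetTwo P p₀ p₁ p₂)
    (hQ : HasJetTwo Q q₀ q₁ q₂) :
    HasJetTwo (fun t => re ((F t * conj (G t)) * (P t * conj (Q t)))) 0 0
      (2 * re ((f * conj g) * (p₀ * conj q₀))) := by
  have h := hasJetTwo_re (hasJetTwo_mul (hasJetTwo_mul hF (hasJetTwo_conj hG))
    (hasJetTwo_mul hP (hasJetTwo_conj hQ)))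
  simpa only [ParaOct.zero_mul, ParaOct.mul_zero, conj_zero, re_zero, add_zero, zero_add,
    smul_zero, smul_mul, re_smul] using h

end ParaOct

namespace ParaOctPlane

open ParaOct

/-! ### The two-jet of the metric at the origin of a chart -/

/-- The numerator of the metric. -/
noncomputable def metricNum (x a b : ParaOctPair) : ℝ :=
  ip a.1 b.1 * (1 + nsq x.2) + ip a.2 b.2 * (1 + nsq x.1)
    - re ((x.1 * conj x.2) * (a.2 * conj b.1)) - re ((x.1 * conj x.2) * (b.2 * conj a.1))

/-- The second order part of the numerator of the metric. -/
noncomputable def metricNumQuad (x a b : ParaOctPair) : ℝ :=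
  ip a.1 b.1 * nsq x.2 + ip a.2 b.2 * nsq x.1
    - re ((x.1 * conj x.2) * (a.2 * conj b.1)) - re ((x.1 * conj x.2) * (b.2 * conj a.1))

theorem metricForm_apply (x a b : ParaOctPair) :
    metricForm x a b = metricNum x a b / (1 + nsq x.1 + nsq x.2) ^ 2 := rfl

theorem metricForm_zero_apply (a b : ParaOctPair) :
    metricForm 0 a b = ip a.1 b.1 + ip a.2 b.2 := by
  simp [metricForm_apply, metricNum, ParaOct.zero_mul, re_zero, nsq_eq]

theorem metricForm_zero_comm (a b : ParaOctPair) : metricForm 0 a b = metricForm 0 b a := by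
  rw [metricForm_zero_apply, metricForm_zero_apply, ip_comm a.1, ip_comm a.2]

theorem eq_zero_of_metricForm_zero {a : ParaOctPair} (h : ∀ b, metricForm 0 a b = 0) : a = 0 := by
  -- Flipping the sign of the second quaternion in each entry turns the split form into the positive
  -- definite one, so this single test vector suffices.
  have h1 := h (ParaOct.mk a.1.1 (-a.1.2), ParaOct.mk a.2.1 (-a.2.2))
  have h2 : Quaternion.normSq a.1.1 + Quaternion.normSq a.1.2
      + (Quaternion.normSq a.2.1 + Quaternion.normSq a.2.2) = 0 := by
    rw [← h1, metricForm_zero_apply, ip_eq, ip_eq]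
    simp [Quaternion.normSq_def']
    ring
  have n1 := Quaternion.normSq_nonneg (a := a.1.1)
  have n2 := Quaternion.normSq_nonneg (a := a.1.2)
  have n3 := Quaternion.normSq_nonneg (a := a.2.1)
  have n4 := Quaternion.normSq_nonneg (a := a.2.2)
  refine Prod.ext (ParaOct.ext ?_ ?_) (ParaOct.ext ?_ ?_) <;>
    exact Quaternion.normSq_eq_zero.1 (by linarith)

/-- The base curve starts at the origin and enters the numerator only quadratically, so it
contributes nothing before second order, and there only through its velocity. -/
theorem hasJetTwo_metricNum {X A B : ℝ → ParaOctPair} {x x' a₀ a₁ a₂ b₀ b₁ b₂ : ParaOctPair}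
    (hX : HasJetTwo X 0 x x') (hA : HasJetTwo A a₀ a₁ a₂) (hB : HasJetTwo B b₀ b₁ b₂) :
    HasJetTwo (fun t => metricNum (X t) (A t) (B t)) (metricForm 0 a₀ b₀)
      (metricForm 0 a₀ b₁ + metricForm 0 a₁ b₀)
      (metricForm 0 a₀ b₂ + 2 * metricForm 0 a₁ b₁ + metricForm 0 a₂ b₀
        + 2 * metricNumQuad x a₀ b₀) := by
  have fst : ∀ {Z : ℝ → ParaOctPair} {z₀ z₁ z₂ : ParaOctPair}, HasJetTwo Z z₀ z₁ z₂ →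
      HasJetTwo (fun t => (Z t).1) z₀.1 z₁.1 z₂.1 :=
    fun h => h.clm (ContinuousLinearMap.fst ℝ ParaOct ParaOct)
  have snd : ∀ {Z : ℝ → ParaOctPair} {z₀ z₁ z₂ : ParaOctPair}, HasJetTwo Z z₀ z₁ z₂ →
      HasJetTwo (fun t => (Z t).2) z₀.2 z₁.2 z₂.2 :=
    fun h => h.clm (ContinuousLinearMap.snd ℝ ParaOct ParaOct)
  have h := ((((hasJetTwo_ip (fst hA) (fst hB)).mul
    ((hasJetTwo_const (1 : ℝ)).add (hasJetTwo_nsq (snd hX)))).add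
      ((hasJetTwo_ip (snd hA) (snd hB)).mul
        ((hasJetTwo_const (1 : ℝ)).add (hasJetTwo_nsq (fst hX))))).sub
      (hasJetTwo_re_mul (fst hX) (snd hX) (snd hA) (fst hB))).sub
      (hasJetTwo_re_mul (fst hX) (snd hX) (snd hB) (fst hA))
  simp only [metricForm_zero_apply, metricNumQuad]
  convert h using 1
  · rfl
  all_goals ring

theorem hasJetTwo_metricDen {X : ℝ → ParaOctPair} {x x' : ParaOctPair}
    (hX : HasJetTwo X 0 x x') :
    HasJetTwo (fun t => (1 + nsq (X t).1 + nsq (X t).2) ^ 2) 1 0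
      (4 * (nsq x.1 + nsq x.2)) := by
  have h := ((hasJetTwo_const (1 : ℝ)).add
    (hasJetTwo_nsq (hX.clm (ContinuousLinearMap.fst ℝ ParaOct ParaOct)))).add
    (hasJetTwo_nsq (hX.clm (ContinuousLinearMap.snd ℝ ParaOct ParaOct)))
  simp only [sq]
  convert h.mul h using 1 <;> simp
  ring

/-- The second order part of the metric at the origin of a chart. -/
noncomputable def metricQuad (x a b : ParaOctPair) : ℝ :=
  metricNumQuad x a b - 2 * metricForm 0 a b * (nsq x.1 + nsq x.2)

/-! ### The curvature form and its values at the two null vectors -/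

/-- The curvature form `R(x, a, a, x)` at the origin of a chart, up to a factor. -/
noncomputable def curvature (x a : ParaOctPair) : ℝ :=
  metricQuad x a a + metricQuad a x x
    - (metricQuad (x + a) x a - metricQuad x x a - metricQuad a x a)

/-- Since e is null and the second entry is 0, nearly everything vanishes. The surviving term comes
from the factor |x|² in `metricQuad`, polarized to 2⟨e,a₁⟩ and multiplied by g₀(x,a). The
para-octonionic product enters through (e ā₂)(a₂ ē), which is a multiple of |e|² by `core_identity`.
-/
theorem curvature_of_left_null {e : ParaOct} (he : nsq e = 0) (a : ParaOctPair) :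
    curvature (e, 0) a = 4 * metricForm 0 (e, 0) a ^ 2 := by
  obtain ⟨a₁, a₂⟩ := a
  have h1 : re ((e * conj a₂) * (a₂ * conj e)) = nsq a₂ * nsq e := by
    rw [core_identity _ _ _ (Or.inr (Or.inr (Or.inl rfl))), re_smul]; rfl
  have h2 : nsq (e + a₁) = nsq e + 2 * ip e a₁ + nsq a₁ := by
    simp only [nsq_eq, ip_eq, fst_add, snd_add, Quaternion.re_add, Quaternion.imI_add,
      Quaternion.imJ_add, Quaternion.imK_add]
    ring
  have h3 : ip e e = 0 := he
  have h4 : ∀ c, ip c 0 = 0 := fun c => by simp [ip_eq]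
  have h5 : ∀ c, ip 0 c = 0 := fun c => by simp [ip_eq]
  have h6 : nsq 0 = 0 := by simp [nsq_eq]
  simp only [curvature, metricQuad, metricNumQuad, metricForm_zero_apply, Prod.mk_add_mk, zero_add,
    ParaOct.zero_mul, ParaOct.mul_zero, conj_zero, re_zero, h2, h3, he, h4, h5, h6,
    ParaOct.add_mul, re_add, h1]
  ring

/-- The null vector (1,l) mixes both factors. Here g₀((1,l),(i,0)) = 0, so the formula for null
vectors (e,0) would predict 0; each of the three groups of terms in `curvature` contributes |i|²|l|²
= -1 instead. -/
theorem curvature_one_l_i_zero :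
    curvature (1, l) (ParaOct.i, 0) = -3 := by
  simp [curvature, metricQuad, metricNumQuad, metricForm_zero_apply, nsq_eq, ip_eq, re,
    fst_i_re, fst_i_imI, fst_i_imJ, fst_i_imK, snd_i, fst_l, snd_l]
  norm_num

/-! ### Isometries fixing the origin preserve the curvature -/

section Isometry

variable {F : ParaOctPair → ParaOctPair}

/-- Comparison of the two-jets of `F^* g` and of `g` along the line through `x`. -/
theorem metric_jet_comparison (hF : ContDiffAt ℝ 3 F 0) (h0 : F 0 = 0)
    (hiso : ∀ᶠ x in 𝓝 0, ∀ a b,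
      metricForm (F x) (fderiv ℝ F x a) (fderiv ℝ F x b) = metricForm x a b)
    (x a b : ParaOctPair) :
    metricForm 0 (fderiv ℝ F 0 a) (fderiv ℝ F 0 b) = metricForm 0 a b ∧
    metricForm 0 (fderiv ℝ F 0 a) (fderiv ℝ (fderiv ℝ F) 0 x b)
      + metricForm 0 (fderiv ℝ (fderiv ℝ F) 0 x a) (fderiv ℝ F 0 b) = 0 ∧
    metricForm 0 (fderiv ℝ F 0 a) (fderiv ℝ (fderiv ℝ (fderiv ℝ F)) 0 x x b)
      + 2 * metricForm 0 (fderiv ℝ (fderiv ℝ F) 0 x a) (fderiv ℝ (fderiv ℝ F) 0 x b)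
      + metricForm 0 (fderiv ℝ (fderiv ℝ (fderiv ℝ F)) 0 x x a) (fderiv ℝ F 0 b)
      + 2 * metricQuad (fderiv ℝ F 0 x) (fderiv ℝ F 0 a) (fderiv ℝ F 0 b)
      = 2 * metricQuad x a b := by
  have hX := (hF.of_le (by norm_num : (2 : WithTop ℕ∞) ≤ 3)).hasJetTwo_line x
  rw [h0] at hX
  have hD := (hF.fderiv_right (m := 2) (by norm_num)).hasJetTwo_line x
  have hA := fun c => hD.clm (ContinuousLinearMap.apply ℝ ParaOctPair c)
  have hI : HasJetTwo (fun t : ℝ => t • x) 0 x 0 := by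
    have h := (contDiffAt_id (𝕜 := ℝ) (n := 2) (x := (0 : ParaOctPair))).hasJetTwo_line x
    have e : fderiv ℝ (id : ParaOctPair → ParaOctPair)
        = fun _ => ContinuousLinearMap.id ℝ ParaOctPair := funext fun y => fderiv_id
    rw [e, fderiv_fun_const] at h
    exact h
  have hl : Filter.Tendsto (fun t : ℝ => t • x) (𝓝 0) (𝓝 0) := by
    have h : Continuous fun t : ℝ => t • x := by fun_prop
    simpa using h.tendsto 0
  have hpos : ∀ᶠ y in 𝓝 (0 : ParaOctPair), 0 < 1 + nsq y.1 + nsq y.2 :=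
    isOpen_chartTarget.mem_nhds (by simp [chartTarget, nsq_eq])
  have hposF : ∀ᶠ y in 𝓝 (0 : ParaOctPair), 0 < 1 + nsq (F y).1 + nsq (F y).2 := by
    have h := hF.continuousAt.tendsto
    rw [h0] at h
    exact h.eventually hpos
  -- The isometry equation is compared with denominators cleared, which avoids jets of quotients;
  -- both denominators are positive near 0.
  have h := HasJetTwo.unique
    ((hasJetTwo_metricNum hX (hA a) (hA b)).mul (hasJetTwo_metricDen hI))
    ((hasJetTwo_metricNum hI (hasJetTwo_const a) (hasJetTwo_const b)).mul (hasJetTwo_metricDen hX))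
    (by
      filter_upwards [hl.eventually hiso, hl.eventually hpos, hl.eventually hposF] with t h1 h2 h3
      have h4 := h1 a b
      rw [metricForm_apply, metricForm_apply, div_eq_div_iff (by positivity) (by positivity)] at h4
      exact h4)
  simp only [ContinuousLinearMap.apply_apply, map_zero, LinearMap.zero_apply] at h
  obtain ⟨e0, e1, e2⟩ := h
  have e0 : metricForm 0 (fderiv ℝ F 0 a) (fderiv ℝ F 0 b) = metricForm 0 a b := by linarith
  refine ⟨e0, by linarith, ?_⟩
  simp only [metricQuad]
  -- The cleared denominators contribute multiples of g₀(a,b) and of g₀(DF a, DF b). Their equality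
  -- lets these terms be absorbed into the two `metricQuad` values.
  rw [e0] at e2 ⊢
  linarith

/-- Nondegeneracy of g₀ makes DF injective, and the dimension is finite. -/
theorem fderiv_surjective_of_isometry (hF : ContDiffAt ℝ 3 F 0) (h0 : F 0 = 0)
    (hiso : ∀ᶠ x in 𝓝 0, ∀ a b,
      metricForm (F x) (fderiv ℝ F x a) (fderiv ℝ F x b) = metricForm x a b) :
    Function.Surjective (fderiv ℝ F 0) := by
  have hinj : Function.Injective (fderiv ℝ F 0 : ParaOctPair →ₗ[ℝ] ParaOctPair) := by
    refine (injective_iff_map_eq_zero _).2 fun a ha => eq_zero_of_metricForm_zero fun b => ?_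
    have h := (metric_jet_comparison hF h0 hiso 0 a b).1
    have ha : fderiv ℝ F 0 a = 0 := ha
    rw [← h, ha, map_zero, LinearMap.zero_apply]
  exact LinearMap.injective_iff_surjective.1 hinj

/-- An isometry fixing the origin, where the metric is stationary, has no second derivative. -/
theorem sndFDeriv_eq_zero_of_isometry (hF : ContDiffAt ℝ 3 F 0) (h0 : F 0 = 0)
    (hiso : ∀ᶠ x in 𝓝 0, ∀ a b,
      metricForm (F x) (fderiv ℝ F x a) (fderiv ℝ F x b) = metricForm x a b)
    (x a : ParaOctPair) :
    fderiv ℝ (fderiv ℝ F) 0 x a = 0 := by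
  have hs : ∀ y z, fderiv ℝ (fderiv ℝ F) 0 y z = fderiv ℝ (fderiv ℝ F) 0 z y :=
    fun y z => (hF.isSymmSndFDerivAt (by simp; norm_num)).eq y z
  -- The trilinear form g₀(D²F(x,a), DF b) is symmetric in x, a and antisymmetric in a, b, hence
  -- zero: the three permuted identities combine to this.
  have hb : ∀ b, metricForm 0 (fderiv ℝ (fderiv ℝ F) 0 x a) (fderiv ℝ F 0 b) = 0 := by
    intro b
    have e1 := (metric_jet_comparison hF h0 hiso x a b).2.1
    have e2 := (metric_jet_comparison hF h0 hiso a b x).2.1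
    have e3 := (metric_jet_comparison hF h0 hiso b x a).2.1
    rw [metricForm_zero_comm (fderiv ℝ F 0 _)] at e1 e2 e3
    rw [hs a x] at e2
    rw [hs b x, hs b a] at e3
    linarith
  refine eq_zero_of_metricForm_zero fun c => ?_
  obtain ⟨b, rfl⟩ := fderiv_surjective_of_isometry hF h0 hiso c
  exact hb b

/-- Once D²F = 0, the change of `metricQuad` involves D³F alone. In the combination `curvature`, the
terms with D³F(x,x,a) and D³F(a,a,x) each occur with coefficients 2 and -2. -/
theorem curvature_fderiv_of_isometry (hF : ContDiffAt ℝ 3 F 0) (h0 : F 0 = 0)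
    (hiso : ∀ᶠ x in 𝓝 0, ∀ a b,
      metricForm (F x) (fderiv ℝ F x a) (fderiv ℝ F x b) = metricForm x a b)
    (x a : ParaOctPair) :
    curvature (fderiv ℝ F 0 x) (fderiv ℝ F 0 a) = curvature x a := by
  have key : ∀ y b c, metricForm 0 (fderiv ℝ (fderiv ℝ (fderiv ℝ F)) 0 y y c) (fderiv ℝ F 0 b)
      + metricForm 0 (fderiv ℝ (fderiv ℝ (fderiv ℝ F)) 0 y y b) (fderiv ℝ F 0 c)
      + 2 * metricQuad (fderiv ℝ F 0 y) (fderiv ℝ F 0 b) (fderiv ℝ F 0 c)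
      = 2 * metricQuad y b c := by
    intro y b c
    have e := (metric_jet_comparison hF h0 hiso y b c).2.2
    rw [sndFDeriv_eq_zero_of_isometry hF h0 hiso, metricForm_zero_comm (fderiv ℝ F 0 b)] at e
    simpa using e
  have k1 := key x a a
  have k2 := key a x x
  have k3 := key (x + a) x a
  have k4 := key x x a
  have k5 := key a x a
  -- Expanding D³F(x+a, x+a, ·) yields its mixed terms; the symmetries below bring them to the forms
  -- occurring in `k1` and `k2`.
  simp only [map_add, add_apply, LinearMap.add_apply] at k3
  have e1 : fderiv ℝ (fderiv ℝ (fderiv ℝ F)) 0 a x a = fderiv ℝ (fderiv ℝ (fderiv ℝ F)) 0 a a x :=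
    hF.thirdFDeriv_symm_right a x a
  have e2 : fderiv ℝ (fderiv ℝ (fderiv ℝ F)) 0 x a x = fderiv ℝ (fderiv ℝ (fderiv ℝ F)) 0 x x a :=
    hF.thirdFDeriv_symm_right x a x
  have e3 : fderiv ℝ (fderiv ℝ (fderiv ℝ F)) 0 x a = fderiv ℝ (fderiv ℝ (fderiv ℝ F)) 0 a x :=
    hF.thirdFDeriv_symm_left x a
  rw [e3] at e2
  simp only [e3, e1, e2] at k3
  simp only [curvature]
  linarith

end Isometry

theorem not_isometry_of_fderiv_null {F : ParaOctPair → ParaOctPair} (hF : ContDiffAt ℝ 3 F 0)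
    (h0 : F 0 = 0)
    (hiso : ∀ᶠ x in 𝓝 0, ∀ a b,
      metricForm (F x) (fderiv ℝ F x a) (fderiv ℝ F x b) = metricForm x a b) :
    fderiv ℝ F 0 (i + l, 0) ≠ (1, l) := by
  intro hvw
  obtain ⟨a, ha⟩ := fderiv_surjective_of_isometry hF h0 hiso (ParaOct.i, 0)
  have hc := curvature_fderiv_of_isometry hF h0 hiso (i + l, 0) a
  have hm := (metric_jet_comparison hF h0 hiso 0 (i + l, 0) a).1
  have hn : nsq (i + l) = 0 := by
    simp [nsq_eq, fst_i_re, fst_i_imI, fst_i_imJ, fst_i_imK, snd_i, fst_l, snd_l]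
  rw [curvature_of_left_null hn, ← hm, hvw, ha, curvature_one_l_i_zero, metricForm_zero_apply] at hc
  -- At this point `hc` equates four times a square with -3.
  nlinarith [sq_nonneg (ip (1 : ParaOct) ParaOct.i + ip l 0)]

/-! ### Passage to the chart at the base point -/

/-- The preferred chart is the one of least admissible index, so chart 0 is used on all of its
domain. Near the base point both tangent vectors and the metric are therefore read in one fixed
chart. -/
theorem chartAt_of_mem {P : ParaOctPlane} (hP : P ∈ chartSource 0) :
    chartAt ParaOctPair P = chart 0 := by
  classical
  rw [chartAt_eq]
  congr 1
  exact (Fin.find_eq_iff _).2 ⟨hP, fun j hj => absurd hj (Fin.not_lt_zero j)⟩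

theorem basePoint_mem_chartSource : basePoint ∈ chartSource 0 := by
  rw [basePoint, mk_mem_chartSource]
  simp [nsq_eq]

theorem chart_basePoint : chart 0 basePoint = 0 := by
  refine Prod.ext ?_ ?_
  · exact coord_mk_of_eq_one (j := 1) rfl
  · exact coord_mk_of_eq_one (j := 2) rfl

theorem mfderiv_eq_fderiv_chart {f : ParaOctPlane → ParaOctPlane} {P : ParaOctPlane}
    (hP : P ∈ chartSource 0) (hfP : f P ∈ chartSource 0)
    (hf : MDifferentiableAt 𝓘(ℝ, ParaOctPair) 𝓘(ℝ, ParaOctPair) f P) (a : ParaOctPair) :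
    (mfderiv 𝓘(ℝ, ParaOctPair) 𝓘(ℝ, ParaOctPair) f P a : ParaOctPair) =
      fderiv ℝ (chart 0 ∘ f ∘ (chart 0).symm) (chart 0 P) a := by
  rw [hf.mfderiv]
  simp only [writtenInExtChartAt, extChartAt, chartAt_of_mem hP, chartAt_of_mem hfP, mfld_simps,
    fderivWithin_univ]
  rfl

theorem not_existsLocalIsometryMapping :
    ¬ ExistsLocalIsometryMapping 𝓘(ℝ, ParaOctPair) metric basePoint
      (baseVec (i + l) 0) (baseVec 1 l) := by
  rintro ⟨f, hp, hiso, hT⟩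
  have hfp : f basePoint = basePoint := congrArg Bundle.TotalSpace.proj hT
  have hd : (mfderiv 𝓘(ℝ, ParaOctPair) 𝓘(ℝ, ParaOctPair) f basePoint (baseVec (i + l) 0) :
      ParaOctPair) = (1, l) :=
    congrArg (fun z : TangentBundle 𝓘(ℝ, ParaOctPair) ParaOctPlane => (z.2 : ParaOctPair)) hT
  have hb := basePoint_mem_chartSource
  have hfb : f basePoint ∈ chartSource 0 := hfp.symm ▸ hb
  have hsymm : (chart 0).symm 0 = basePoint := by
    rw [← chart_basePoint]
    exact (chart 0).left_inv hb
  set F : ParaOctPair → ParaOctPair := chart 0 ∘ f ∘ (chart 0).symm with hFdef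
  have hF0 : F 0 = 0 := by
    simp only [hFdef, Function.comp_apply, hsymm, hfp, chart_basePoint]
  have hmd : ∀ P ∈ f.source, MDifferentiableAt 𝓘(ℝ, ParaOctPair) 𝓘(ℝ, ParaOctPair) f P :=
    fun P hP => f.mdifferentiableAt (by simp) hP
  have hcd : ContDiffAt ℝ ∞ F 0 := by
    have h1 : ContMDiffAt 𝓘(ℝ, ParaOctPair) 𝓘(ℝ, ParaOctPair) ∞ f basePoint :=
      f.contMDiffOn.contMDiffAt (f.open_source.mem_nhds hp)
    have h2 := (contMDiffAt_iff.1 h1).2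
    simp only [extChartAt, chartAt_of_mem hb, chartAt_of_mem hfb, mfld_simps,
      contDiffWithinAt_univ, chart_basePoint] at h2
    exact h2
  have hlim : Filter.Tendsto (chart 0).symm (𝓝 0) (𝓝 basePoint) := by
    have h := (chart 0).symm.continuousAt (x := 0)
      (by rw [← chart_basePoint]; exact (chart 0).map_source hb)
    rw [ContinuousAt, hsymm] at h
    exact h
  -- The jet argument needs the isometry equation on a neighbourhood, so the domain is shrunk until
  -- P and f(P) are both covered by chart 0.
  have hsrc : ∀ᶠ P in 𝓝 basePoint, P ∈ f.source ∧ f P ∈ chartSource 0 := by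
    have hc := (hmd _ hp).continuousAt.tendsto
    rw [hfp] at hc
    exact Filter.Eventually.and (f.open_source.mem_nhds hp)
      (hc.eventually ((isOpen_chartSource 0).mem_nhds hb))
  have htgt : ∀ᶠ x in 𝓝 (0 : ParaOctPair), x ∈ (chart 0).target :=
    (chart 0).open_target.mem_nhds (by rw [← chart_basePoint]; exact (chart 0).map_source hb)
  refine not_isometry_of_fderiv_null (F := F)
    (hcd.of_le (WithTop.coe_le_coe.2 (le_top : (3 : ℕ∞) ≤ ⊤))) hF0 ?_ ?_
  · filter_upwards [hlim.eventually hsrc, htgt] with x ⟨hx1, hx2⟩ hx3 a b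
    have hx4 : (chart 0).symm x ∈ chartSource 0 := (chart 0).map_target hx3
    have h := hiso _ hx1 a b
    have ha := mfderiv_eq_fderiv_chart hx4 hx2 (hmd _ hx1)
    rw [(chart 0).right_inv hx3] at ha
    simp only [metric, chartAt_of_mem hx4, chartAt_of_mem hx2, (chart 0).right_inv hx3] at h
    rw [← ha a, ← ha b]
    exact h
  · rw [← hd, ← chart_basePoint]
    exact (mfderiv_eq_fderiv_chart hb hfb (hmd _ hp) _).symm

theorem metric_basePoint : metric basePoint = metricForm 0 := by
  rw [metric, chartAt_basePoint, chart_basePoint]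

end ParaOctPlane

/-- The vectors `v = (i+l, 0)` and `w = (1, l)` at `[1,0,0] ∈ 𝕆'P²` are non-zero and null, no local
isometry of `𝕆'P²` fixing `[1,0,0]` maps `v` to `w`, and so `𝕆'P²` is not locally isotropic. -/
theorem mainTheorem5 :
    (ParaOctPlane.baseVec (ParaOct.i + ParaOct.l) 0 ≠ 0 ∧
      ParaOctPlane.baseVec 1 ParaOct.l ≠ 0 ∧
      ParaOctPlane.metric ParaOctPlane.basePoint
        (ParaOctPlane.baseVec (ParaOct.i + ParaOct.l) 0)
        (ParaOctPlane.baseVec (ParaOct.i + ParaOct.l) 0) = 0 ∧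
      ParaOctPlane.metric ParaOctPlane.basePoint
        (ParaOctPlane.baseVec 1 ParaOct.l) (ParaOctPlane.baseVec 1 ParaOct.l) = 0 ∧
      ¬ ExistsLocalIsometryMapping 𝓘(ℝ, ParaOctPair) ParaOctPlane.metric ParaOctPlane.basePoint
        (ParaOctPlane.baseVec (ParaOct.i + ParaOct.l) 0) (ParaOctPlane.baseVec 1 ParaOct.l)) ∧
    ¬ IsLocallyIsotropic 𝓘(ℝ, ParaOctPair) ParaOctPlane.metric := by
  have hv : ParaOctPlane.baseVec (ParaOct.i + ParaOct.l) 0 ≠ 0 := fun h => by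
    have h1 : (ParaOct.i + ParaOct.l).1.imI = 0 :=
      congrArg (fun z : ParaOctPair => z.1.1.imI) h
    simp [ParaOct.fst_i_imI, ParaOct.fst_l] at h1
  have hw : ParaOctPlane.baseVec 1 ParaOct.l ≠ 0 := fun h => by
    have h1 : (1 : ParaOct).1.re = 0 := congrArg (fun z : ParaOctPair => z.1.1.re) h
    simp at h1
  have hvv : ParaOctPlane.metric ParaOctPlane.basePoint
      (ParaOctPlane.baseVec (ParaOct.i + ParaOct.l) 0)
      (ParaOctPlane.baseVec (ParaOct.i + ParaOct.l) 0) = 0 := by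
    rw [ParaOctPlane.metric_basePoint]
    refine (ParaOctPlane.metricForm_zero_apply _ _).trans ?_
    simp [ParaOctPlane.baseVec, ParaOct.ip_eq, ParaOct.fst_i_re, ParaOct.fst_i_imI,
      ParaOct.fst_i_imJ, ParaOct.fst_i_imK, ParaOct.snd_i, ParaOct.fst_l, ParaOct.snd_l]
  have hww : ParaOctPlane.metric ParaOctPlane.basePoint
      (ParaOctPlane.baseVec 1 ParaOct.l) (ParaOctPlane.baseVec 1 ParaOct.l) = 0 := by
    rw [ParaOctPlane.metric_basePoint]
    refine (ParaOctPlane.metricForm_zero_apply _ _).trans ?_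
    simp [ParaOctPlane.baseVec, ParaOct.ip_eq, ParaOct.fst_l, ParaOct.snd_l]
  have hne := ParaOctPlane.not_existsLocalIsometryMapping
  exact ⟨⟨hv, hw, hvv, hww, hne⟩, fun h => hne (h _ _ _ hv hw (hvv.trans hww.symm))⟩
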